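/- Let $n\ge 0$ be an integer. An $n$-dimensional process $Z(t)=(Z_1(t),\dots,Z_n(t))$, $t\in[0,1]$, has the Sign Choice (SC) property if for every choice of signs $(s_1,\dots,s_n)\in\{+,-\}^n$, with probability one there exists some $t_0\in[0,1]$ such that for every $j=1,\dots,n$ one has $Z_j(t_0)>0$ if $s_j=+$ and $Z_j(t_0)<0$ if $s_j=-$. Standard $n$-dimensional Brownian motion on $[0,1]$ is a process $(B_1,\dots,B_n)$ whose coordinates are independent standard real Brownian motions on $[0,1]$ (started at $0$, with independent increments, with $B_j(t)-B_j(s)\sim N(0,t-s)$ for $s\le t$, and with almost surely continuous paths). The law of a process is its distribution on the product (cylinder) $\sigma$-algebra of the space of functions on $[0,1]$. (a) Standard $n$-dimensional Brownian motion on $[0,1]$ has the SC property. (b) Every $n$-dimensional process on $[0,1]$ (possibly defined on another probability space) whose law is absolutely continuous with respect to the law of standard $n$-dimensional Brownian motion on $[0,1]$ has the SC property. In particular, so does every $n$-dimensional process on $[0,1]$ whose coordinate processes $X_1,\dots,X_n$ are independent and each have a law absolutely continuous with respect to the law of standard real Brownian motion on $[0,1]$. -/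

import Mathlib

open MeasureTheory ProbabilityTheory
open scoped unitInterval

/-- The random path `ω ↦ (t ↦ Z t ω)` of a process indexed by `[0,1]`, as a map into the space of
all functions on `[0,1]`, which carries the product (cylinder) σ-algebra. -/
def pathMap {Ω E : Type*} (Z : I → Ω → E) : Ω → (I → E) :=
  fun ω t => Z t ω

/-- The law of a process indexed by `[0,1]`, as a measure on the cylinder σ-algebra of path space.
It is used for processes all of whose `Z t` are measurable; then `pathMap Z` is measurable. -/
noncomputable def processLaw {Ω E : Type*} [MeasurableSpace Ω] [MeasurableSpace E]
    (Z : I → Ω → E) (P : Measure Ω) : Measure (I → E) :=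
  P.map (pathMap Z)

/-- Standard real Brownian motion on `[0,1]`. -/
structure IsBrownianUnit {Ω : Type*} [MeasurableSpace Ω] (B : I → Ω → ℝ) (P : Measure Ω) :
    Prop where
  measurable : ∀ t, Measurable (B t)
  start : ∀ᵐ ω ∂P, B 0 ω = 0
  indep_increments : HasIndepIncrements B P
  law_increment : ∀ s t : I, s ≤ t →
    HasLaw (fun ω => B t ω - B s ω) (gaussianReal 0 (Real.toNNReal ((t : ℝ) - (s : ℝ)))) P
  continuous_paths : ∀ᵐ ω ∂P, Continuous (fun t => B t ω)

/-- Standard `n`-dimensional Brownian motion on `[0,1]`: the coordinates are independent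
(as random paths) standard real Brownian motions. -/
structure IsBrownianUnitVec {Ω : Type*} [MeasurableSpace Ω] {n : ℕ}
    (B : I → Ω → (Fin n → ℝ)) (P : Measure Ω) : Prop where
  coord : ∀ j, IsBrownianUnit (fun t ω => B t ω j) P
  indep : iIndepFun (fun j => pathMap (fun t ω => B t ω j)) P

/-- The Sign Choice property of an `n`-dimensional process on `[0,1]`. The signs `+` and `-` are
the nonzero elements of `SignType`, and the sign of the real number `0` is `0`. -/
def SignChoice {Ω : Type*} [MeasurableSpace Ω] {n : ℕ}
    (Z : I → Ω → (Fin n → ℝ)) (P : Measure Ω) : Prop :=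
  ∀ s : Fin n → SignType, (∀ j, s j ≠ 0) →
    ∀ᵐ ω ∂P, ∃ t₀ : I, ∀ j, SignType.sign (Z t₀ ω j) = s j

/-!
Fix a choice of signs `s`. Brownian motion takes these signs already along the deterministic
sequence of times `t k = 1 / ((k + 1)!)²`, which decreases to `0` faster than geometrically:
`t (k + 1)` is at most `t k - t (k + 1)` divided by `(k + 1)²`.

* The events that all increments `B j (t k) - B j (t (k + 1))` have the sign `s j` and exceed their
  standard deviation `√(t k - t (k + 1))` in absolute value are independent and have the same
  positive probability, so infinitely many of them occur, by the second Borel–Cantelli lemma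
  (`IsBrownianUnitVec.ae_frequently_sqrt_lt`).
* By Chebyshev's inequality the probability that `|B j (t (k + 1))| ≥ √(t k - t (k + 1))` is
  summable in `k`, so this happens only finitely often, by the first Borel–Cantelli lemma
  (`IsBrownianUnitVec.ae_eventually_abs_lt`).

For a `k` at which the increments are large and the values `B j (t (k + 1))` are small, `B j (t k)`
has the sign of the increment.

Only countably many times are involved, so the event is measurable for the cylinder σ-algebra and
its full probability passes to every absolutely continuous law
(`IsBrownianUnitVec.signChoice_of_absolutelyContinuous`). When the coordinates are independent, the
law of the process is, up to exchanging time and coordinate, the product of the coordinate laws,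
and products preserve absolute continuity (`processLaw_absolutelyContinuous_pi`).
-/

/-! ### Product measures and independence -/

theorem MeasureTheory.Measure.AbsolutelyContinuous.pi_fin {n : ℕ} {α : Fin n → Type*}
    [∀ i, MeasurableSpace (α i)] {μ ν : ∀ i, Measure (α i)}
    [∀ i, SigmaFinite (μ i)] [∀ i, SigmaFinite (ν i)] (h : ∀ i, μ i ≪ ν i) :
    Measure.pi μ ≪ Measure.pi ν := by
  induction n with
  | zero => rw [Measure.pi_of_empty, Measure.pi_of_empty]
  | succ n ih =>
    have hμ := (measurePreserving_piFinSuccAbove μ 0).symm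
    have hν := (measurePreserving_piFinSuccAbove ν 0).symm
    rw [← hμ.map_eq, ← hν.map_eq]
    exact ((h 0).prod (ih fun j => h _)).map hν.measurable

theorem ProbabilityTheory.iIndepFun.comp_measurePreserving {Ω Ω' ι : Type*} [Fintype ι]
    [MeasurableSpace Ω] [MeasurableSpace Ω'] {P : Measure Ω} {Q : Measure Ω'}
    [IsProbabilityMeasure P] [IsProbabilityMeasure Q] {E : ι → Type*}
    [∀ i, MeasurableSpace (E i)] {f : ∀ i, Ω → E i} (hf : iIndepFun f P)
    (hm : ∀ i, Measurable (f i)) {φ : Ω' → Ω} (hφ : MeasurePreserving φ Q P) :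
    iIndepFun (fun i ω => f i (φ ω)) Q := by
  have hmφ : ∀ i, Measurable fun ω => f i (φ ω) := fun i => (hm i).comp hφ.measurable
  rw [iIndepFun_iff_map_fun_eq_pi_map fun i => (hm i).aemeasurable] at hf
  rw [iIndepFun_iff_map_fun_eq_pi_map fun i => (hmφ i).aemeasurable]
  have hmap : ∀ i, Q.map (fun ω => f i (φ ω)) = P.map (f i) := fun i => by
    rw [← hφ.map_eq, Measure.map_map (hm i) hφ.measurable]; rfl
  have hjoint : Q.map (fun ω i => f i (φ ω)) = P.map fun ω i => f i ω := by
    rw [← hφ.map_eq, Measure.map_map (measurable_pi_lambda _ hm) hφ.measurable]; rfl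
  simp_rw [hjoint, hf, hmap]

/-- Along a decreasing sequence of times the increments are independent as well: on a finite set of
indices, reversing the order of the times gives an increasing sequence. -/
theorem ProbabilityTheory.HasIndepIncrements.nat_antitone {T Ω E : Type*} [Preorder T]
    [MeasurableSpace Ω] [MeasurableSpace E] [Sub E] {X : T → Ω → E} {P : Measure Ω}
    (hX : HasIndepIncrements X P) {t : ℕ → T} (ht : Antitone t) :
    iIndepFun (fun k ω => X (t k) ω - X (t (k + 1)) ω) P := by
  refine iIndepFun_iff_finset.2 fun S => ?_
  obtain ⟨N, hN⟩ := S.exists_nat_subset_range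
  have hlt : ∀ k : S, (k : ℕ) < N := fun k => Finset.mem_range.1 (hN k.2)
  have hτ : Monotone fun m => t (N - m) := fun a b hab => ht (by omega)
  have h := (hX.nat hτ).precomp (g := fun k : S => N - 1 - (k : ℕ)) fun a b hab => by
    have ha := hlt a
    have hb := hlt b
    exact Subtype.ext (by simp only at hab; omega)
  convert h using 4 with k
  have := hlt k
  simp only [Finset.restrict]
  congr 3 <;> omega

/-! ### Increments of real Brownian motion -/

theorem measurable_pathMap {Ω E : Type*} [MeasurableSpace Ω] [MeasurableSpace E]
    {Z : I → Ω → E} (hZ : ∀ t, Measurable (Z t)) : Measurable (pathMap Z) :=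
  measurable_pi_lambda _ hZ

namespace IsBrownianUnit

variable {Ω : Type*} [MeasurableSpace Ω] {B : I → Ω → ℝ} {P : Measure Ω}

/-- The probability that a Brownian increment, taken with a prescribed sign `ε`, exceeds its
standard deviation does not depend on the increment. -/
theorem measure_sqrt_lt_mul_sub (hB : IsBrownianUnit B P) {s t : I} (hst : s < t) {ε : ℝ}
    (hε : ε ^ 2 = 1) :
    P {ω | √((t : ℝ) - s) < ε * (B t ω - B s ω)} = gaussianReal 0 1 (Set.Ioi 1) := by
  have hpos : 0 < (t : ℝ) - s := sub_pos.2 hst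
  have hsq := Real.sqrt_pos.2 hpos
  have h := gaussianReal_const_mul (hB.law_increment s t hst.le) (ε / √((t : ℝ) - s))
  have hv : NNReal.mk ((ε / √((t : ℝ) - s)) ^ 2) (sq_nonneg _) * ((t : ℝ) - s).toNNReal = 1 := by
    ext
    simp only [NNReal.coe_mul, NNReal.coe_mk, Real.coe_toNNReal _ hpos.le, NNReal.coe_one, div_pow,
      hε, Real.sq_sqrt hpos.le]
    field_simp
  rw [mul_zero, hv] at h
  have := h.measure_eq (p := fun x => 1 < x) measurableSet_Ioi
  rw [← Set.Ioi_def, ← this]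
  congr 1
  ext ω
  simp only [Set.mem_ofPred_eq, div_mul_eq_mul_div, one_lt_div hsq]

/-- Chebyshev's inequality for `B s`, against the standard deviation of a later increment. -/
theorem measure_sqrt_le_abs (hB : IsBrownianUnit B P) {s t : I} (hst : s < t) :
    P {ω | √((t : ℝ) - s) ≤ |B s ω|} ≤ ENNReal.ofReal (s / ((t : ℝ) - s)) := by
  have hpos : 0 < (t : ℝ) - s := sub_pos.2 hst
  have hlaw : HasLaw (B s) (gaussianReal 0 (s : ℝ).toNNReal) P := by
    have h := hB.law_increment 0 s unitInterval.nonneg'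
    simp only [Set.Icc.coe_zero, sub_zero] at h
    refine h.congr ?_
    filter_upwards [hB.start] with ω hω
    simp [hω]
  have hm : MeasurableSet {x : ℝ | √((t : ℝ) - s) ≤ |x|} :=
    measurableSet_le measurable_const measurable_id.abs
  rw [hlaw.measure_eq (p := fun x => √((t : ℝ) - s) ≤ |x|) hm]
  have h := meas_ge_le_variance_div_sq (memLp_id_gaussianReal (μ := 0) (v := (s : ℝ).toNNReal) 2)
    (Real.sqrt_pos.2 hpos)
  rw [variance_id_gaussianReal, Real.sq_sqrt hpos.le, Real.coe_toNNReal _ s.2.1] at h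
  simpa using h

theorem comp_measurePreserving [IsProbabilityMeasure P] {Ω' : Type*} [MeasurableSpace Ω']
    {Q : Measure Ω'} [IsProbabilityMeasure Q] (hB : IsBrownianUnit B P) {φ : Ω' → Ω}
    (hφ : MeasurePreserving φ Q P) : IsBrownianUnit (fun t ω => B t (φ ω)) Q where
  measurable t := (hB.measurable t).comp hφ.measurable
  start := hφ.quasiMeasurePreserving.ae hB.start
  indep_increments n t ht := (hB.indep_increments n t ht).comp_measurePreserving
    (fun _ => (hB.measurable _).sub (hB.measurable _)) hφ
  law_increment s t hst := (hB.law_increment s t hst).fun_comp hφ.hasLaw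
  continuous_paths := hφ.quasiMeasurePreserving.ae hB.continuous_paths

end IsBrownianUnit

/-! ### A fast decreasing sequence of times -/

/-- The times `1 / ((k + 1)!)²`, which decrease so fast that Brownian motion at time
`fastTime (k + 1)` is negligible against its increment up to `fastTime k`. -/
noncomputable def fastTime (k : ℕ) : I :=
  ⟨1 / ((k + 1).factorial : ℝ) ^ 2, by positivity, by
    have : (1 : ℝ) ≤ (k + 1).factorial := by exact_mod_cast (k + 1).factorial_pos
    exact div_le_one_of_le₀ (one_le_pow₀ this) (by positivity)⟩

theorem coe_fastTime_succ (k : ℕ) :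
    (fastTime k : ℝ) = ((k : ℝ) + 2) ^ 2 * (fastTime (k + 1) : ℝ) := by
  have : ((k + 1).factorial : ℝ) ≠ 0 := by positivity
  simp only [fastTime, Nat.factorial_succ (k + 1), Nat.cast_mul]
  push_cast
  field_simp
  ring

theorem fastTime_pos (k : ℕ) : 0 < (fastTime k : ℝ) := by
  simp only [fastTime]
  positivity

theorem fastTime_strictAnti : StrictAnti fastTime := by
  refine strictAnti_nat_of_succ_lt fun k => Subtype.coe_lt_coe.1 ?_
  rw [coe_fastTime_succ k]
  nlinarith [fastTime_pos (k + 1), k.cast_nonneg (α := ℝ),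
    mul_nonneg (k.cast_nonneg (α := ℝ)) (fastTime_pos (k + 1)).le,
    mul_nonneg (sq_nonneg (k : ℝ)) (fastTime_pos (k + 1)).le]

theorem fastTime_ratio_le (k : ℕ) :
    (fastTime (k + 1) : ℝ) / ((fastTime k : ℝ) - fastTime (k + 1)) ≤ 1 / ((k : ℝ) + 1) ^ 2 := by
  have h := fastTime_pos (k + 1)
  have hk := k.cast_nonneg (α := ℝ)
  have : (fastTime k : ℝ) - fastTime (k + 1) =
      (fastTime (k + 1) : ℝ) * (((k : ℝ) + 1) * (k + 3)) := by
    rw [coe_fastTime_succ k]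
    ring
  rw [this, ← div_div, div_self h.ne']
  gcongr
  nlinarith

/-! ### Signs of `n`-dimensional Brownian motion -/

theorem gaussianReal_Ioi_one_ne_zero : gaussianReal 0 1 (Set.Ioi 1) ≠ 0 := fun h => by
  have := gaussianReal_absolutelyContinuous' 0 one_ne_zero h
  simp at this

theorem measurableSet_sign_eq {Ω : Type*} [MeasurableSpace Ω] {f : Ω → ℝ} (hf : Measurable f)
    (e : SignType) : MeasurableSet {ω | SignType.sign (f ω) = e} := by
  cases e with
  | zero => simpa using measurableSet_eq_fun hf (measurable_const (a := (0 : ℝ)))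
  | pos =>
    have h := measurableSet_lt (measurable_const (a := (0 : ℝ))) hf
    simpa only [SignType.pos_eq_one, sign_eq_one_iff] using h
  | neg =>
    have h := measurableSet_lt hf (measurable_const (a := (0 : ℝ)))
    simpa only [SignType.neg_eq_neg_one, sign_eq_neg_one_iff] using h

theorem sign_eq_of_abs_lt {e : SignType} (he : e ≠ 0) {x y c : ℝ} (hx : c < (e : ℝ) * (x - y))
    (hy : |y| < c) : SignType.sign x = e := by
  have := abs_lt.1 hy
  cases e with
  | zero => exact absurd rfl he
  | pos => exact sign_pos (by simp at hx; linarith)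
  | neg => exact sign_neg (by simp at hx; linarith)

namespace IsBrownianUnitVec

variable {Ω : Type*} [MeasurableSpace Ω] {n : ℕ} {B : I → Ω → (Fin n → ℝ)} {P : Measure Ω}

theorem measurable (hB : IsBrownianUnitVec B P) (t : I) : Measurable (B t) :=
  measurable_pi_lambda _ fun j => (hB.coord j).measurable t

/-- The increments between successive times `fastTime (k + 1)` and `fastTime k` exceed their
standard deviation, in every coordinate with the prescribed sign, for infinitely many `k`: these
are independent events of the same positive probability. -/
theorem ae_frequently_sqrt_lt [IsProbabilityMeasure P] (hB : IsBrownianUnitVec B P)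
    {s : Fin n → SignType} (hs : ∀ j, s j ≠ 0) :
    ∀ᵐ ω ∂P, ∃ᶠ k in Filter.atTop, ∀ j, √((fastTime k : ℝ) - fastTime (k + 1)) <
      (s j : ℝ) * (B (fastTime k) ω j - B (fastTime (k + 1)) ω j) := by
  -- the corresponding sets of paths of a single coordinate
  let D : Fin n → ℕ → Set (I → ℝ) := fun j k =>
    {w | √((fastTime k : ℝ) - fastTime (k + 1)) <
      (s j : ℝ) * (w (fastTime k) - w (fastTime (k + 1)))}
  let F : Fin n → Ω → (I → ℝ) := fun j => pathMap fun t ω => B t ω j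
  have hD : ∀ j k, MeasurableSet (D j k) := fun j k => measurableSet_lt (by fun_prop) (by fun_prop)
  have hF : ∀ j, Measurable (F j) := fun j => measurable_pathMap (hB.coord j).measurable
  have hone : ∀ j k, P (F j ⁻¹' D j k) = gaussianReal 0 1 (Set.Ioi 1) := fun j k =>
    (hB.coord j).measure_sqrt_lt_mul_sub (fastTime_strictAnti k.lt_succ_self) (by
      have := hs j
      generalize s j = e at this
      cases e <;> simp_all)
  have hprod : ∀ S : Finset ℕ, P (⋂ k ∈ S, ⋂ j, F j ⁻¹' D j k) =
      ∏ j, ∏ k ∈ S, P (F j ⁻¹' D j k) := fun S => by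
    have hcoord : ∀ j, P (F j ⁻¹' ⋂ k ∈ S, D j k) = ∏ k ∈ S, P (F j ⁻¹' D j k) := fun j => by
      have h := (hB.coord j).indep_increments.nat_antitone fastTime_strictAnti.antitone
      have h' := h.measure_inter_preimage_eq_mul S
        (sets := fun k => {x | √((fastTime k : ℝ) - fastTime (k + 1)) < (s j : ℝ) * x})
        fun k _ => measurableSet_lt measurable_const (measurable_id.const_mul _)
      rw [Set.preimage_iInter₂]
      exact h'
    have h := hB.indep.measure_inter_preimage_eq_mul Finset.univ
      (sets := fun j => ⋂ k ∈ S, D j k) fun j _ => S.measurableSet_biInter fun k _ => hD j k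
    simp only [← hcoord]
    rw [← h]
    congr 1
    ext ω
    simp only [Set.mem_iInter, Set.mem_preimage, Finset.mem_univ, true_implies, F]
    exact ⟨fun h j k hk => h k hk j, fun h k hk j => h j k hk⟩
  have hA : ∀ k, MeasurableSet (⋂ j, F j ⁻¹' D j k) := fun k =>
    MeasurableSet.iInter fun j => hF j (hD j k)
  have hAk : ∀ k, P (⋂ j, F j ⁻¹' D j k) = gaussianReal 0 1 (Set.Ioi 1) ^ n := fun k => by
    simpa [hone] using hprod {k}
  have hindep : iIndepSet (fun k => ⋂ j, F j ⁻¹' D j k) P := by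
    refine (iIndepSet_iff_meas_biInter hA).2 fun S => ?_
    rw [hprod]
    simp [hone, hAk, ← pow_mul, mul_comm]
  have hlim := measure_limsup_eq_one hA hindep (by
    simp only [hAk]
    exact ENNReal.tsum_const_eq_top_of_ne_zero (pow_ne_zero _ gaussianReal_Ioi_one_ne_zero))
  have hae := (prob_compl_eq_zero_iff (MeasurableSet.measurableSet_limsup hA)).2 hlim
  filter_upwards [compl_mem_ae_iff.2 hae] with ω hω
  rw [compl_compl, Filter.mem_limsup_iff_frequently_mem] at hω
  exact hω.mono fun k hk => by simpa [F, D, pathMap] using hk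

theorem ae_eventually_abs_lt (hB : IsBrownianUnitVec B P) :
    ∀ᵐ ω ∂P, ∀ᶠ k in Filter.atTop, ∀ j,
      |B (fastTime (k + 1)) ω j| < √((fastTime k : ℝ) - fastTime (k + 1)) := by
  simp only [Filter.eventually_all]
  intro j
  have hsum : Summable fun k : ℕ => 1 / ((k : ℝ) + 1) ^ 2 := by
    simpa using (summable_nat_add_iff 1).2 (Real.summable_one_div_nat_pow.2 one_lt_two)
  have hle : ∀ k, P {ω | √((fastTime k : ℝ) - fastTime (k + 1)) ≤ |B (fastTime (k + 1)) ω j|} ≤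
      ENNReal.ofReal (1 / ((k : ℝ) + 1) ^ 2) := fun k =>
    ((hB.coord j).measure_sqrt_le_abs (fastTime_strictAnti k.lt_succ_self)).trans
      (ENNReal.ofReal_le_ofReal (fastTime_ratio_le k))
  have hne := ne_top_of_le_ne_top hsum.tsum_ofReal_ne_top (ENNReal.tsum_le_tsum hle)
  filter_upwards [ae_eventually_notMem hne] with ω hω
  exact hω.mono fun k hk => not_le.1 hk

/-- Brownian motion takes the prescribed signs at one of countably many fixed times, so that
the event in question belongs to the cylinder σ-algebra. -/
theorem ae_exists_sign_fastTime [IsProbabilityMeasure P] (hB : IsBrownianUnitVec B P)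
    {s : Fin n → SignType} (hs : ∀ j, s j ≠ 0) :
    ∀ᵐ ω ∂P, ∃ k, ∀ j, SignType.sign (B (fastTime k) ω j) = s j := by
  filter_upwards [hB.ae_frequently_sqrt_lt hs, hB.ae_eventually_abs_lt] with ω h₁ h₂
  obtain ⟨k, hk₁, hk₂⟩ := (h₁.and_eventually h₂).exists
  exact ⟨k, fun j => sign_eq_of_abs_lt (hs j) (hk₁ j) (hk₂ j)⟩

theorem signChoice [IsProbabilityMeasure P] (hB : IsBrownianUnitVec B P) : SignChoice B P :=
  fun _ hs => (hB.ae_exists_sign_fastTime hs).mono fun _ ⟨k, hk⟩ => ⟨fastTime k, hk⟩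

theorem signChoice_of_absolutelyContinuous [IsProbabilityMeasure P] (hB : IsBrownianUnitVec B P)
    {Ω' : Type*} [MeasurableSpace Ω'] {P' : Measure Ω'} {X : I → Ω' → (Fin n → ℝ)}
    (hX : ∀ t, Measurable (X t)) (hac : processLaw X P' ≪ processLaw B P) : SignChoice X P' := by
  intro s hs
  have hm : MeasurableSet
      {w : I → Fin n → ℝ | ∃ k, ∀ j, SignType.sign (w (fastTime k) j) = s j} := by
    simp only [Set.ofPred_exists, Set.ofPred_forall]
    refine MeasurableSet.iUnion fun k => MeasurableSet.iInter fun j => ?_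
    have : Measurable fun w : I → Fin n → ℝ => w (fastTime k) j :=
      (measurable_pi_apply j).comp (measurable_pi_apply (fastTime k))
    exact measurableSet_sign_eq this (s j)
  have hlaw : ∀ᵐ w ∂processLaw B P, ∃ k, ∀ j, SignType.sign (w (fastTime k) j) = s j :=
    (ae_map_iff (measurable_pathMap hB.measurable).aemeasurable hm).2
      (hB.ae_exists_sign_fastTime hs)
  filter_upwards [(ae_map_iff (measurable_pathMap hX).aemeasurable hm).1 (hac.ae_le hlaw)]
    with ω ⟨k, hk⟩
  exact ⟨fastTime k, hk⟩

end IsBrownianUnitVec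

/-! ### Processes with independent coordinates -/

/-- Independent copies of a real Brownian motion, on a power of its probability space, form a
standard `n`-dimensional Brownian motion. -/
theorem IsBrownianUnit.isBrownianUnitVec_pi {Ω : Type*} [MeasurableSpace Ω] {W : I → Ω → ℝ}
    {P : Measure Ω} [IsProbabilityMeasure P] (hW : IsBrownianUnit W P) (n : ℕ) :
    IsBrownianUnitVec (fun t (ω : Fin n → Ω) j => W t (ω j)) (Measure.pi fun _ => P) where
  coord j := hW.comp_measurePreserving (measurePreserving_eval (fun _ : Fin n => P) j)
  indep := iIndepFun_pi (X := fun _ : Fin n => pathMap W)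
    fun _ => (measurable_pathMap hW.measurable).aemeasurable

theorem processLaw_eq_map_pi {Ω : Type*} [MeasurableSpace Ω] {P : Measure Ω}
    [IsProbabilityMeasure P] {n : ℕ} {X : I → Ω → (Fin n → ℝ)} (hX : ∀ t, Measurable (X t))
    (hind : iIndepFun (fun j => pathMap (fun t ω => X t ω j)) P) :
    processLaw X P =
      (Measure.pi fun j => processLaw (fun t ω => X t ω j) P).map fun f t j => f j t := by
  have hm : ∀ j, Measurable (pathMap fun t ω => X t ω j) := fun j =>
    measurable_pathMap fun t => (measurable_pi_apply j).comp (hX t)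
  simp only [processLaw]
  rw [← (iIndepFun_iff_map_fun_eq_pi_map fun j => (hm j).aemeasurable).1 hind,
    Measure.map_map (by fun_prop) (measurable_pi_lambda _ hm)]
  rfl

/-- A process with independent coordinates whose laws are absolutely continuous with respect to
that of `W` has a law absolutely continuous with respect to that of independent copies of `W`. -/
theorem processLaw_absolutelyContinuous_pi {Ω Ω' : Type*} [MeasurableSpace Ω]
    [MeasurableSpace Ω'] {P : Measure Ω} [IsProbabilityMeasure P] {P' : Measure Ω'}
    [IsProbabilityMeasure P'] {n : ℕ} {W : I → Ω → ℝ} (hW : IsBrownianUnit W P)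
    {X : I → Ω' → (Fin n → ℝ)} (hX : ∀ t, Measurable (X t))
    (hind : iIndepFun (fun j => pathMap (fun t ω => X t ω j)) P')
    (hac : ∀ j, processLaw (fun t ω => X t ω j) P' ≪ processLaw W P) :
    processLaw X P' ≪
      processLaw (fun t (ω : Fin n → Ω) j => W t (ω j)) (Measure.pi fun _ => P) := by
  have hB := hW.isBrownianUnitVec_pi n
  have hWm := measurable_pathMap hW.measurable
  have hcoord : ∀ j : Fin n, processLaw (fun t (ω : Fin n → Ω) => W t (ω j))
      (Measure.pi fun _ => P) = processLaw W P := fun j => by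
    have he := measurePreserving_eval (fun _ : Fin n => P) j
    simp only [processLaw]
    conv_rhs => rw [← he.map_eq, Measure.map_map hWm he.measurable]
    rfl
  rw [processLaw_eq_map_pi hX hind, processLaw_eq_map_pi hB.measurable hB.indep]
  simp only [hcoord]
  have : ∀ j, IsProbabilityMeasure (processLaw (fun t ω => X t ω j) P') := fun j =>
    Measure.isProbabilityMeasure_map
      (measurable_pathMap fun t => (measurable_pi_apply j).comp (hX t)).aemeasurable
  have : IsProbabilityMeasure (processLaw W P) := Measure.isProbabilityMeasure_map hWm.aemeasurable
  exact (Measure.AbsolutelyContinuous.pi_fin hac).map (by fun_prop)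

theorem proposition3 {Ω Ω' : Type*} [MeasurableSpace Ω] [MeasurableSpace Ω']
    (P : Measure Ω) [IsProbabilityMeasure P] (P' : Measure Ω') [IsProbabilityMeasure P'] (n : ℕ) :
    -- (a) Brownian motion
    (∀ B : I → Ω → (Fin n → ℝ), IsBrownianUnitVec B P → SignChoice B P) ∧
    -- (b) law absolutely continuous with respect to that of `n`-dimensional Brownian motion
    (∀ (B : I → Ω → (Fin n → ℝ)) (X : I → Ω' → (Fin n → ℝ)),
      IsBrownianUnitVec B P → (∀ t, Measurable (X t)) →
      processLaw X P' ≪ processLaw B P → SignChoice X P') ∧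
    -- (b) independent coordinates, each with law absolutely continuous with respect to that of
    -- real Brownian motion
    (∀ (W : I → Ω → ℝ) (X : I → Ω' → (Fin n → ℝ)),
      IsBrownianUnit W P → (∀ t, Measurable (X t)) →
      iIndepFun (fun j => pathMap (fun t ω => X t ω j)) P' →
      (∀ j, processLaw (fun t ω => X t ω j) P' ≪ processLaw W P) → SignChoice X P') :=
  ⟨fun _ hB => hB.signChoice,
    fun _ _ hB hX hac => hB.signChoice_of_absolutelyContinuous hX hac,
    fun _ _ hW hX hind hac => (hW.isBrownianUnitVec_pi n).signChoice_of_absolutelyContinuous hX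
      (processLaw_absolutelyContinuous_pi hW hX hind hac)⟩
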